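/- Let $G$ be a finite abelian group, and let $\underline{A}_G$ be its Burnside Tambara functor: $\underline{A}_G(G/H)=A(H)$ is the Burnside ring of $H$ for each subgroup $H\le G$, and for $K\le H$ the restriction, transfer and norm are $Y\mapsto Y|_K$, $X\mapsto H\times_K X$ and $X\mapsto \mathrm{Map}_K(H,X)$ (the norm being extended to virtual $K$-sets as a polynomial map of degree at most $|H:K|$), together with the conjugation maps $c_{g,H}\colon A(H)\to A(H^g)$, where $H^g=g^{-1}Hg$. An ideal $\mathscr{I}$ of $\underline{A}_G$ is a family of ring ideals $\mathscr{I}(G/H)\subseteq A(H)$, $H\le G$, closed under restrictions, transfers and conjugations, and such that $N_K^H(\mathscr{I}(G/K))\subseteq \mathscr{I}(G/H)+N_K^H(0)$ for all $K\le H\le G$. For a finite $G$-set $X\cong\coprod_i G/K_i$ put $\mathscr{I}(X)=\prod_i\mathscr{I}(G/K_i)$. An ideal $\mathscr{P}$ is prime if for all ideals $\mathscr{I},\mathscr{J}$ with $\mathscr{I}\mathscr{J}\subseteq\mathscr{P}$ one has $\mathscr{I}\subseteq\mathscr{P}$ or $\mathscr{J}\subseteq\mathscr{P}$, where $(\mathscr{I}\mathscr{J})(G/H)$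 consists of all $f_+(ab)$ with $f\colon A\to G/H$ a map of finite $G$-sets, $f_+$ its transfer, $a\in\mathscr{I}(A)$ and $b\in\mathscr{J}(A)$. Let $\mathscr{P}$ be a prime ideal of $\underline{A}_G$ and let $p$ be a prime number or zero. If $p\cdot e/e\in\mathscr{P}(G/e)$, where $e$ is the trivial subgroup, then $p\cdot H/H\in\mathscr{P}(G/H)$ for every subgroup $H\le G$. -/

import Mathlib

universe u

/-! ### Finite `Γ`-sets and their isomorphism classes -/

/-- A finite (left) `Γ`-set. -/
structure FinGSet (Γ : Type u) [Group Γ] where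
  carrier : Type u
  [act : MulAction Γ carrier]
  [fin : Finite carrier]

namespace FinGSet

variable {Γ Δ : Type u} [Group Γ] [Group Δ]

instance instMulActionCarrier (X : FinGSet Γ) : MulAction Γ X.carrier := X.act

instance instFiniteCarrier (X : FinGSet Γ) : Finite X.carrier := X.fin

/-- Isomorphism of `Γ`-sets: a `Γ`-equivariant bijection exists. -/
def Iso (X Y : FinGSet Γ) : Prop :=
  ∃ e : X.carrier ≃ Y.carrier, ∀ (g : Γ) (x : X.carrier), e (g • x) = g • e x

theorem Iso.rfl {X : FinGSet Γ} : Iso X X := ⟨Equiv.refl _, fun _ _ => _root_.rfl⟩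

theorem Iso.symm {X Y : FinGSet Γ} (h : Iso X Y) : Iso Y X := by
  obtain ⟨e, he⟩ := h
  exact ⟨e.symm, fun g y => e.injective (by simp [he])⟩

theorem Iso.trans {X Y Z : FinGSet Γ} (h : Iso X Y) (h' : Iso Y Z) : Iso X Z := by
  obtain ⟨e, he⟩ := h
  obtain ⟨e', he'⟩ := h'
  exact ⟨e.trans e', fun g x => by simp [he, he']⟩

instance isoSetoid (Γ : Type u) [Group Γ] : Setoid (FinGSet Γ) where
  r := Iso
  iseqv := ⟨fun _ => Iso.rfl, Iso.symm, Iso.trans⟩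

/-- The empty `Γ`-set. -/
def empty (Γ : Type u) [Group Γ] : FinGSet Γ :=
  letI : MulAction Γ PEmpty.{u + 1} :=
    { smul := fun _ x => x, one_smul := fun _ => rfl, mul_smul := fun _ _ _ => rfl }
  { carrier := PEmpty }

/-- The one-point `Γ`-set. -/
def point (Γ : Type u) [Group Γ] : FinGSet Γ :=
  letI : MulAction Γ PUnit.{u + 1} :=
    { smul := fun _ x => x, one_smul := fun _ => rfl, mul_smul := fun _ _ _ => rfl }
  { carrier := PUnit }

/-- Disjoint union. -/
def sum (X Y : FinGSet Γ) : FinGSet Γ := { carrier := X.carrier ⊕ Y.carrier }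

/-- Cartesian product with the diagonal action. -/
def prod (X Y : FinGSet Γ) : FinGSet Γ := { carrier := X.carrier × Y.carrier }

/-- The transitive `Γ`-set `Γ/K`. -/
def coset [Finite Γ] (K : Subgroup Γ) : FinGSet Γ := { carrier := Γ ⧸ K }

/-- Restriction of a `Γ`-set along a homomorphism `f : Δ → Γ`. -/
def restrict (f : Δ →* Γ) (X : FinGSet Γ) : FinGSet Δ :=
  letI : MulAction Δ X.carrier := MulAction.compHom X.carrier f
  { carrier := X.carrier }

/-- The relation on `Γ × X` defining `Γ ×_Δ X`: `(h · f k, x) ∼ (h, k • x)` for `k ∈ Δ`. -/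
def inducedSetoid (f : Δ →* Γ) (X : FinGSet Δ) : Setoid (Γ × X.carrier) where
  r a b := ∃ k : Δ, a.1 = b.1 * f k ∧ b.2 = k • a.2
  iseqv :=
    { refl := fun a => ⟨1, by simp, by simp⟩
      symm := by
        rintro a b ⟨k, h1, h2⟩
        exact ⟨k⁻¹, by simp [h1], by simp [h2]⟩
      trans := by
        rintro a b c ⟨k, h1, h2⟩ ⟨l, h3, h4⟩
        exact ⟨l * k, by simp [h1, h3, mul_assoc], by simp [h2, h4, mul_smul]⟩ }

instance inducedMulAction (f : Δ →* Γ) (X : FinGSet Δ) :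
    MulAction Γ (Quotient (inducedSetoid f X)) where
  smul g := Quotient.map (fun a => (g * a.1, a.2)) (by
    rintro a b ⟨k, h1, h2⟩
    exact ⟨k, by simp [h1, mul_assoc], h2⟩)
  one_smul := by
    rintro ⟨a⟩
    exact congrArg (Quotient.mk _) (Prod.ext (one_mul _) rfl)
  mul_smul := by
    rintro g h ⟨a⟩
    exact congrArg (Quotient.mk _) (Prod.ext (mul_assoc _ _ _) rfl)

/-- The induced `Γ`-set `Γ ×_Δ X` (for `f : Δ → Γ` the inclusion of a subgroup). -/
def induce [Finite Γ] (f : Δ →* Γ) (X : FinGSet Δ) : FinGSet Γ :=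
  { carrier := Quotient (inducedSetoid f X) }

/-- The set `Map_Δ(Γ, X)` of `Δ`-equivariant maps from `Γ` to `X`. -/
def CoindCarrier (f : Δ →* Γ) (X : FinGSet Δ) : Type u :=
  { s : Γ → X.carrier // ∀ (k : Δ) (h : Γ), s (f k * h) = k • s h }

instance coindMulAction (f : Δ →* Γ) (X : FinGSet Δ) : MulAction Γ (CoindCarrier f X) where
  smul g s := ⟨fun h => s.1 (h * g), fun k h =>
    (congrArg s.1 (mul_assoc _ _ _)).trans (s.2 k (h * g))⟩
  one_smul _ := Subtype.ext (funext fun h => congrArg _ (mul_one h))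
  mul_smul _ _ _ := Subtype.ext (funext fun h => congrArg _ (mul_assoc h _ _).symm)

instance coindFinite [Finite Γ] (f : Δ →* Γ) (X : FinGSet Δ) : Finite (CoindCarrier f X) :=
  inferInstanceAs (Finite { s : Γ → X.carrier // ∀ (k : Δ) (h : Γ), s (f k * h) = k • s h })

/-- The coinduced `Γ`-set `Map_Δ(Γ, X)`, with `(g • s)(h) = s (h * g)`. -/
def coinduce [Finite Γ] (f : Δ →* Γ) (X : FinGSet Δ) : FinGSet Γ :=
  { carrier := CoindCarrier f X }

/-- Number of points of `X` fixed by all elements of `I` (the mark of `I` on `X`). -/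
noncomputable def mark (I : Subgroup Γ) (X : FinGSet Γ) : ℕ :=
  Nat.card { x : X.carrier // ∀ g ∈ I, g • x = x }

theorem mark_congr {I : Subgroup Γ} {X Y : FinGSet Γ} (h : Iso X Y) : mark I X = mark I Y := by
  obtain ⟨e, he⟩ := h
  refine Nat.card_congr (e.subtypeEquiv fun x => ?_)
  simp [← he]

theorem mark_sum (I : Subgroup Γ) (X Y : FinGSet Γ) :
    mark I (X.sum Y) = mark I X + mark I Y := by
  unfold mark
  rw [← Nat.card_sum]
  refine Nat.card_congr ?_
  refine (Equiv.subtypeSum (p := fun x : X.carrier ⊕ Y.carrier => ∀ g ∈ I, g • x = x)).trans ?_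
  refine Equiv.sumCongr (Equiv.subtypeEquivRight fun x => ?_) (Equiv.subtypeEquivRight fun x => ?_)
  · exact forall₂_congr fun g _ => Sum.inl_injective.eq_iff
  · exact forall₂_congr fun g _ => Sum.inr_injective.eq_iff

theorem sum_congr {X X' Y Y' : FinGSet Γ} (h : Iso X X') (h' : Iso Y Y') :
    Iso (X.sum Y) (X'.sum Y') := by
  obtain ⟨e, he⟩ := h
  obtain ⟨e', he'⟩ := h'
  refine ⟨Equiv.sumCongr e e', ?_⟩
  rintro g (x | x)
  · exact congrArg Sum.inl (he g x)
  · exact congrArg Sum.inr (he' g x)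

theorem prod_congr {X X' Y Y' : FinGSet Γ} (h : Iso X X') (h' : Iso Y Y') :
    Iso (X.prod Y) (X'.prod Y') := by
  obtain ⟨e, he⟩ := h
  obtain ⟨e', he'⟩ := h'
  exact ⟨Equiv.prodCongr e e', fun g x => Prod.ext (he g x.1) (he' g x.2)⟩

theorem restrict_congr (f : Δ →* Γ) {X Y : FinGSet Γ} (h : Iso X Y) :
    Iso (X.restrict f) (Y.restrict f) := by
  obtain ⟨e, he⟩ := h
  exact ⟨e, fun k x => he (f k) x⟩

theorem induce_congr [Finite Γ] (f : Δ →* Γ) {X Y : FinGSet Δ} (h : Iso X Y) :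
    Iso (X.induce f) (Y.induce f) := by
  obtain ⟨e, he⟩ := h
  refine ⟨Quotient.congr (Equiv.prodCongr (Equiv.refl Γ) e) ?_, ?_⟩
  · rintro ⟨a, x⟩ ⟨b, y⟩
    refine exists_congr fun k => and_congr Iff.rfl ?_
    change y = k • x ↔ e y = k • e x
    rw [← he, e.injective.eq_iff]
  · rintro g ⟨a, x⟩
    rfl

theorem coinduce_congr [Finite Γ] (f : Δ →* Γ) {X Y : FinGSet Δ} (h : Iso X Y) :
    Iso (X.coinduce f) (Y.coinduce f) := by
  obtain ⟨e, he⟩ := h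
  refine ⟨(Equiv.arrowCongr (Equiv.refl Γ) e).subtypeEquiv fun s => ?_, ?_⟩
  · refine forall₂_congr fun k h => ?_
    change _ ↔ e (s (f k * h)) = k • e (s h)
    rw [← he, e.injective.eq_iff]
  · intro g s
    rfl

theorem induce_sum [Finite Γ] (f : Δ →* Γ) (X Y : FinGSet Δ) :
    Iso ((X.sum Y).induce f) ((X.induce f).sum (Y.induce f)) := by
  let toF : Γ × (X.carrier ⊕ Y.carrier) →
      Quotient (inducedSetoid f X) ⊕ Quotient (inducedSetoid f Y) := fun a =>
    Sum.map (fun x => Quotient.mk _ (a.1, x)) (fun y => Quotient.mk _ (a.1, y)) a.2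
  let F : Quotient (inducedSetoid f (X.sum Y)) →
      Quotient (inducedSetoid f X) ⊕ Quotient (inducedSetoid f Y) :=
    Quotient.lift toF (by
      rintro ⟨a, x⟩ ⟨b, y⟩ ⟨k, h1, h2⟩
      rcases x with x | x
      · change y = Sum.inl (k • x) at h2
        subst h2
        exact congrArg Sum.inl (Quotient.sound ⟨k, h1, rfl⟩)
      · change y = Sum.inr (k • x) at h2
        subst h2
        exact congrArg Sum.inr (Quotient.sound ⟨k, h1, rfl⟩))
  let B : Quotient (inducedSetoid f X) ⊕ Quotient (inducedSetoid f Y) →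
      Quotient (inducedSetoid f (X.sum Y)) :=
    Sum.elim
      (Quotient.lift (fun a => Quotient.mk _ (a.1, Sum.inl a.2)) (by
        rintro ⟨a, x⟩ ⟨b, y⟩ ⟨k, h1, h2⟩
        exact Quotient.sound ⟨k, h1, congrArg Sum.inl h2⟩))
      (Quotient.lift (fun a => Quotient.mk _ (a.1, Sum.inr a.2)) (by
        rintro ⟨a, x⟩ ⟨b, y⟩ ⟨k, h1, h2⟩
        exact Quotient.sound ⟨k, h1, congrArg Sum.inr h2⟩))
  refine ⟨⟨F, B, ?_, ?_⟩, ?_⟩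
  · rintro ⟨a, x | x⟩ <;> rfl
  · rintro (⟨a, x⟩ | ⟨a, x⟩) <;> rfl
  · rintro g ⟨a, x | x⟩ <;> rfl

/-- Splitting off the orbit of `x` from `X`, compatibly with any orbit having the same stabiliser in
another `Γ`-set. -/
theorem split_orbit (X : FinGSet Γ) (x : X.carrier) :
    ∃ R : FinGSet Γ, Nat.card R.carrier < Nat.card X.carrier ∧
      ∀ (Y : FinGSet Γ) (y : Y.carrier),
        MulAction.stabilizer Γ y = MulAction.stabilizer Γ x →
        ∃ S : FinGSet Γ, (Iso R S → Iso X Y) ∧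
          ∀ I : Subgroup Γ, mark I X = mark I Y → mark I R = mark I S := by
  classical
  -- the complement of an orbit
  have key : ∀ (Z : FinGSet Γ) (z : Z.carrier), ∃ (O R : FinGSet Γ), Iso (O.sum R) Z ∧
      Nat.card R.carrier < Nat.card Z.carrier ∧
      ∃ e : O.carrier ≃ MulAction.orbit Γ z, ∀ (g : Γ) (o : O.carrier),
        (e (g • o) : Z.carrier) = g • (e o : Z.carrier) := by
    intro Z z
    let a1 : MulAction Γ { w : Z.carrier // w ∈ MulAction.orbit Γ z } :=
      { smul := fun g w => ⟨g • w.1, by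
          obtain ⟨h, hh⟩ := w.2
          refine ⟨g * h, ?_⟩
          change (g * h) • z = g • w.1
          change h • z = w.1 at hh
          rw [mul_smul, hh]⟩
        one_smul := fun w => Subtype.ext (one_smul _ _)
        mul_smul := fun g h w => Subtype.ext (mul_smul _ _ _) }
    let a2 : MulAction Γ { w : Z.carrier // ¬ w ∈ MulAction.orbit Γ z } :=
      { smul := fun g w => ⟨g • w.1, fun hw => w.2 (by
          obtain ⟨h, hh⟩ := hw
          refine ⟨g⁻¹ * h, ?_⟩
          change (g⁻¹ * h) • z = w.1
          change h • z = g • w.1 at hh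
          rw [mul_smul, hh, inv_smul_smul])⟩
        one_smul := fun w => Subtype.ext (one_smul _ _)
        mul_smul := fun g h w => Subtype.ext (mul_smul _ _ _) }
    refine ⟨{ carrier := { w : Z.carrier // w ∈ MulAction.orbit Γ z } },
      { carrier := { w : Z.carrier // ¬ w ∈ MulAction.orbit Γ z } },
      ⟨Equiv.sumCompl (fun w => w ∈ MulAction.orbit Γ z), ?_⟩, ?_, Equiv.refl _, fun _ _ => rfl⟩
    · rintro g (w | w) <;> rfl
    · exact Finite.card_subtype_lt (x := z) (by simp)
  obtain ⟨O, R, i1, c1, e, he⟩ := key X x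
  refine ⟨R, c1, fun Y y hs => ?_⟩
  obtain ⟨O', S, i2, -, e', he'⟩ := key Y y
  have hO : Iso O O' := by
    have fwd : ∀ g h : Γ, g • x = h • x ↔ g • y = h • y := fun g h => by
      have : ∀ {Z : FinGSet Γ} (z : Z.carrier), g • z = h • z ↔
          h⁻¹ * g ∈ MulAction.stabilizer Γ z := fun z => by
        rw [MulAction.mem_stabilizer_iff, mul_smul, inv_smul_eq_iff]
      rw [this, this, hs]
    let m : MulAction.orbit Γ x → MulAction.orbit Γ y :=
      fun w => ⟨(Classical.choose w.2) • y, ⟨_, rfl⟩⟩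
    have hm : ∀ (g : Γ) (w : MulAction.orbit Γ x), w.1 = g • x → (m w).1 = g • y := fun g w hw =>
      (fwd _ _).1 ((Classical.choose_spec w.2).trans hw)
    have bij : Function.Bijective m := by
      constructor
      · rintro ⟨_, g, rfl⟩ ⟨_, h, rfl⟩ hgh
        have := congrArg Subtype.val hgh
        rw [hm g _ rfl, hm h _ rfl] at this
        exact Subtype.ext ((fwd _ _).2 this)
      · rintro ⟨_, g, rfl⟩
        exact ⟨⟨g • x, g, rfl⟩, Subtype.ext (hm g _ rfl)⟩
    refine ⟨e.trans ((Equiv.ofBijective m bij).trans e'.symm), fun g o => ?_⟩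
    apply e'.injective
    apply Subtype.ext
    obtain ⟨h, hh⟩ := (e o).2
    change h • x = _ at hh
    rw [he']
    simp only [Equiv.trans_apply, Equiv.apply_symm_apply, Equiv.ofBijective_apply]
    rw [hm h _ hh.symm, hm (g * h) _ (by rw [he, ← hh, mul_smul]), mul_smul]
  refine ⟨S, fun h => (i1.symm.trans (sum_congr hO h)).trans i2, fun I h => ?_⟩
  rw [← mark_congr i1, ← mark_congr i2, mark_sum, mark_sum, mark_congr hO] at h
  omega

/-- Burnside: a finite `Γ`-set is determined up to isomorphism by its marks. -/
theorem iso_of_mark_eq [Finite Γ] {X Y : FinGSet Γ} (h : ∀ I, mark I X = mark I Y) : Iso X Y := by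
  obtain ⟨n, hn⟩ : ∃ n, n = Nat.card X.carrier := ⟨_, rfl⟩
  induction n using Nat.strong_induction_on generalizing X Y with
  | _ n ih =>
    have hpos : ∀ (Z : FinGSet Γ) (I : Subgroup Γ),
        0 < mark I Z ↔ ∃ z : Z.carrier, I ≤ MulAction.stabilizer Γ z := by
      intro Z I
      unfold mark
      rw [Finite.card_pos_iff]
      exact ⟨fun ⟨z⟩ => ⟨z.1, fun g hg => z.2 g hg⟩, fun ⟨z, hz⟩ => ⟨⟨z, fun g hg => hz hg⟩⟩⟩
    rcases isEmpty_or_nonempty X.carrier with hX | hX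
    · have hY : IsEmpty Y.carrier := by
        refine ⟨fun y => ?_⟩
        obtain ⟨x, -⟩ := (hpos X _).1 ((h _).symm ▸ (hpos Y _).2 ⟨y, le_rfl⟩)
        exact hX.false x
      exact ⟨Equiv.equivOfIsEmpty _ _, fun _ x => (hX.false x).elim⟩
    · obtain ⟨x, hx⟩ := Finite.exists_max
        (fun x : X.carrier => Nat.card (MulAction.stabilizer Γ x))
      obtain ⟨y, hy⟩ := (hpos Y _).1 ((h _) ▸ (hpos X _).2 ⟨x, le_rfl⟩)
      obtain ⟨x', hx'⟩ := (hpos X _).1 ((h _).symm ▸ (hpos Y _).2 ⟨y, le_rfl⟩)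
      have hle : Nat.card (MulAction.stabilizer Γ y) ≤ Nat.card (MulAction.stabilizer Γ x) :=
        (Subgroup.card_le_of_le hx').trans (hx x')
      have hst := Subgroup.eq_of_le_of_card_ge hy hle
      obtain ⟨R, hR, hsplit⟩ := split_orbit X x
      obtain ⟨S, hS, hm⟩ := hsplit Y y hst.symm
      exact hS (ih _ (hn ▸ hR) (fun I => hm I (h I)) rfl)

/-- The equivalence relation of double cosets `Δ \ Γ / I`. -/
def doubleCosetSetoid (f : Δ →* Γ) (I : Subgroup Γ) : Setoid Γ where
  r a b := ∃ k : Δ, ∃ i ∈ I, b = f k * a * i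
  iseqv :=
    { refl := fun a => ⟨1, 1, I.one_mem, by simp⟩
      symm := by
        rintro a b ⟨k, i, hi, rfl⟩
        exact ⟨k⁻¹, i⁻¹, I.inv_mem hi, by simp [mul_assoc]⟩
      trans := by
        rintro a b c ⟨k, i, hi, rfl⟩ ⟨l, j, hj, rfl⟩
        exact ⟨l * k, i * j, I.mul_mem hi hj, by simp [mul_assoc]⟩ }

/-- The marks of a coinduced set: a product of marks over double cosets. -/
theorem mark_coinduce [Finite Γ] (f : Δ →* Γ) (I : Subgroup Γ) :
    ∃ (m : ℕ) (J : Fin m → Subgroup Δ), m ≤ f.range.index ∧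
      ∀ X : FinGSet Δ, mark I (X.coinduce f) = ∏ i, mark (J i) X := by
  classical
  let Ω := Quotient (doubleCosetSetoid f I)
  let J : Ω → Subgroup Δ := fun ω => I.comap ((MulAut.conj (ω.out)⁻¹).toMonoidHom.comp f)
  have hJ : ∀ ω k, k ∈ J ω ↔ (Quotient.out ω)⁻¹ * f k * Quotient.out ω ∈ I := fun ω k => by
    simp [J, Subgroup.mem_comap]
  have : Fintype Ω := Fintype.ofFinite _
  have hcard : Nat.card Ω ≤ f.range.index := by
    rw [Subgroup.index]
    refine Nat.card_le_card_of_surjective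
      (Quotient.lift (fun a : Γ => (Quotient.mk (doubleCosetSetoid f I) a⁻¹ : Ω)) ?_) ?_
    · intro a b hab
      obtain ⟨k, hk⟩ := QuotientGroup.leftRel_apply.1 hab
      refine Quotient.sound ⟨k⁻¹, 1, I.one_mem, ?_⟩
      rw [map_inv, hk]
      group
    · rintro ⟨a⟩
      refine ⟨QuotientGroup.mk a⁻¹, ?_⟩
      change Quotient.mk _ (a⁻¹)⁻¹ = Quotient.mk _ a
      rw [inv_inv]
  have hdec : ∀ h : Γ, ∃ k : Δ, ∃ i ∈ I,
      h = f k * (Quotient.mk (doubleCosetSetoid f I) h).out * i := fun h =>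
    Quotient.exact (Quotient.out_eq (Quotient.mk (doubleCosetSetoid f I) h))
  choose κ ι hι hκ using hdec
  refine ⟨Fintype.card Ω, fun i => J ((Fintype.equivFin Ω).symm i),
    by rwa [← Nat.card_eq_fintype_card], fun X => ?_⟩
  rw [Equiv.prod_comp (Fintype.equivFin Ω).symm (fun ω => mark (J ω) X)]
  unfold mark
  rw [← Nat.card_pi]
  have hinv : ∀ s : { s : CoindCarrier f X // ∀ g ∈ I, g • s = s }, ∀ h, ∀ i ∈ I,
      s.1.1 (h * i) = s.1.1 h := fun s h i hi =>
    congrFun (congrArg Subtype.val (s.2 i hi)) h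
  refine Nat.card_congr
    { toFun := fun s ω => ⟨s.1.1 ω.out, fun k hk => ?_⟩
      invFun := fun t => ⟨⟨fun h => κ h • (t (Quotient.mk _ h)).1, ?_⟩, ?_⟩
      left_inv := ?_
      right_inv := ?_ }
  · rw [hJ] at hk
    rw [← s.1.2]
    have := hinv s (Quotient.out ω) _ hk
    rwa [← mul_assoc, ← mul_assoc, mul_inv_cancel, one_mul] at this
  · intro k h
    have hq : (Quotient.mk (doubleCosetSetoid f I) (f k * h)) = Quotient.mk _ h :=
      Quotient.sound ⟨k⁻¹, 1, I.one_mem, by simp⟩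
    have h1 := hκ (f k * h)
    have h2 := hκ h
    change κ (f k * h) • (t (Quotient.mk _ (f k * h))).1 = k • κ h • (t (Quotient.mk _ h)).1
    rw [hq] at h1 ⊢
    rw [← mul_smul]
    have hmem : (k * κ h)⁻¹ * κ (f k * h) ∈ J (Quotient.mk _ h) := by
      rw [hJ]
      have : (Quotient.mk (doubleCosetSetoid f I) h).out⁻¹ * f ((k * κ h)⁻¹ * κ (f k * h)) *
          (Quotient.mk (doubleCosetSetoid f I) h).out = ι h * (ι (f k * h))⁻¹ := by
        generalize (Quotient.mk (doubleCosetSetoid f I) h).out = o at *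
        have h3 : f (κ (f k * h)) * o = f k * h * (ι (f k * h))⁻¹ := eq_mul_inv_of_mul_eq h1.symm
        have h4 : h = f (κ h) * o * ι h := h2
        simp only [map_mul, map_inv]
        rw [mul_assoc, mul_assoc, h3, eq_comm]
        calc ι h * (ι (f k * h))⁻¹
            = o⁻¹ * ((f k * f (κ h))⁻¹ * (f k * (f (κ h) * o * ι h) * (ι (f k * h))⁻¹)) := by group
          _ = _ := by rw [← h4]
      rw [this]
      exact I.mul_mem (hι _) (I.inv_mem (hι _))
    have := (t (Quotient.mk _ h)).2 _ hmem
    rw [mul_smul, inv_smul_eq_iff] at this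
    exact this
  · intro g hg
    apply Subtype.ext
    funext h
    change κ (h * g) • (t (Quotient.mk _ (h * g))).1 = κ h • (t (Quotient.mk _ h)).1
    have hq : (Quotient.mk (doubleCosetSetoid f I) (h * g)) = Quotient.mk _ h :=
      Quotient.sound ⟨1, g⁻¹, I.inv_mem hg, by simp⟩
    have h1 := hκ (h * g)
    have h2 := hκ h
    rw [hq] at h1 ⊢
    have hmem : (κ h)⁻¹ * κ (h * g) ∈ J (Quotient.mk _ h) := by
      rw [hJ]
      have : (Quotient.mk (doubleCosetSetoid f I) h).out⁻¹ * f ((κ h)⁻¹ * κ (h * g)) *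
          (Quotient.mk (doubleCosetSetoid f I) h).out = ι h * g * (ι (h * g))⁻¹ := by
        generalize (Quotient.mk (doubleCosetSetoid f I) h).out = o at *
        have h3 : f (κ (h * g)) * o = h * g * (ι (h * g))⁻¹ := eq_mul_inv_of_mul_eq h1.symm
        have h4 : h = f (κ h) * o * ι h := h2
        simp only [map_mul, map_inv]
        rw [mul_assoc, mul_assoc, h3, eq_comm]
        calc ι h * g * (ι (h * g))⁻¹
            = o⁻¹ * ((f (κ h))⁻¹ * ((f (κ h) * o * ι h) * g * (ι (h * g))⁻¹)) := by group
          _ = _ := by rw [← h4]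
      rw [this]
      exact I.mul_mem (I.mul_mem (hι _) hg) (I.inv_mem (hι _))
    have := (t (Quotient.mk _ h)).2 _ hmem
    rw [mul_smul, inv_smul_eq_iff] at this
    exact this
  · intro s
    apply Subtype.ext
    apply Subtype.ext
    funext h
    change κ h • s.1.1 (Quotient.mk _ h).out = s.1.1 h
    rw [← s.1.2, ← hinv s _ _ (hι h), ← hκ]
  · intro t
    funext ω
    apply Subtype.ext
    change κ ω.out • (t (Quotient.mk _ ω.out)).1 = (t ω).1
    have h1 := hκ ω.out
    have hq : Quotient.mk _ ω.out = ω := Quotient.out_eq ω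
    rw [hq] at h1 ⊢
    refine (t ω).2 _ ?_
    rw [hJ]
    have : ω.out⁻¹ * f (κ ω.out) * ω.out = (ι ω.out)⁻¹ := by
      rw [mul_assoc, eq_mul_inv_of_mul_eq h1.symm, inv_mul_cancel_left]
    rw [this]
    exact I.inv_mem (hι _)

end FinGSet

/-! ### The Burnside ring -/

/-- Isomorphism classes of finite `Γ`-sets. -/
def FinGSetClass (Γ : Type u) [Group Γ] : Type (u + 1) := Quotient (FinGSet.isoSetoid Γ)

namespace FinGSetClass

variable {Γ Δ : Type u} [Group Γ] [Group Δ]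

/-- The isomorphism class of a finite `Γ`-set. -/
def mk (X : FinGSet Γ) : FinGSetClass Γ := Quotient.mk _ X

instance instAdd : Add (FinGSetClass Γ) :=
  ⟨Quotient.map₂ FinGSet.sum fun _ _ h _ _ h' => FinGSet.sum_congr h h'⟩

instance instMul : Mul (FinGSetClass Γ) :=
  ⟨Quotient.map₂ FinGSet.prod fun _ _ h _ _ h' => FinGSet.prod_congr h h'⟩

instance instZero : Zero (FinGSetClass Γ) := ⟨mk (FinGSet.empty Γ)⟩

instance instOne : One (FinGSetClass Γ) := ⟨mk (FinGSet.point Γ)⟩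

/-- The semiring of finite `Γ`-sets up to isomorphism: addition is disjoint union and
multiplication is the Cartesian product. -/
instance instCommSemiring : CommSemiring (FinGSetClass Γ) where
  nsmul := nsmulRec
  add_assoc := by
    rintro ⟨X⟩ ⟨Y⟩ ⟨Z⟩
    exact Quotient.sound ⟨Equiv.sumAssoc _ _ _, by rintro g ((x | x) | x) <;> rfl⟩
  zero_add := by
    rintro ⟨X⟩
    exact Quotient.sound ⟨Equiv.emptySum PEmpty _, by rintro g (x | x) <;> [cases x; rfl]⟩
  add_zero := by
    rintro ⟨X⟩
    exact Quotient.sound ⟨Equiv.sumEmpty _ PEmpty, by rintro g (x | x) <;> [rfl; cases x]⟩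
  add_comm := by
    rintro ⟨X⟩ ⟨Y⟩
    exact Quotient.sound ⟨Equiv.sumComm _ _, by rintro g (x | x) <;> rfl⟩
  left_distrib := by
    rintro ⟨X⟩ ⟨Y⟩ ⟨Z⟩
    exact Quotient.sound ⟨Equiv.prodSumDistrib _ _ _, by rintro g ⟨x, y | y⟩ <;> rfl⟩
  right_distrib := by
    rintro ⟨X⟩ ⟨Y⟩ ⟨Z⟩
    exact Quotient.sound ⟨Equiv.sumProdDistrib _ _ _, by rintro g ⟨x | x, y⟩ <;> rfl⟩
  zero_mul := by
    rintro ⟨X⟩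
    exact Quotient.sound ⟨Equiv.pemptyProd _, by rintro g ⟨x, y⟩; cases x⟩
  mul_zero := by
    rintro ⟨X⟩
    exact Quotient.sound ⟨Equiv.prodPEmpty _, by rintro g ⟨x, y⟩; cases y⟩
  mul_assoc := by
    rintro ⟨X⟩ ⟨Y⟩ ⟨Z⟩
    exact Quotient.sound ⟨Equiv.prodAssoc _ _ _, by rintro g ⟨⟨x, y⟩, z⟩; rfl⟩
  one_mul := by
    rintro ⟨X⟩
    exact Quotient.sound ⟨Equiv.punitProd _, by rintro g ⟨x, y⟩; rfl⟩
  mul_one := by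
    rintro ⟨X⟩
    exact Quotient.sound ⟨Equiv.prodPUnit _, by rintro g ⟨x, y⟩; rfl⟩
  mul_comm := by
    rintro ⟨X⟩ ⟨Y⟩
    exact Quotient.sound ⟨Equiv.prodComm _ _, by rintro g ⟨x, y⟩; rfl⟩

/-- Restriction of isomorphism classes along a homomorphism. -/
def res (f : Δ →* Γ) : FinGSetClass Γ →+ FinGSetClass Δ where
  toFun := Quotient.map (FinGSet.restrict f) fun _ _ h => FinGSet.restrict_congr f h
  map_zero' := Quotient.sound ⟨Equiv.refl _, fun _ x => x.elim⟩
  map_add' := by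
    rintro ⟨X⟩ ⟨Y⟩
    exact Quotient.sound ⟨Equiv.refl _, by rintro g (x | x) <;> rfl⟩

/-- Induction `X ↦ Γ ×_Δ X` on isomorphism classes. -/
def tr [Finite Γ] (f : Δ →* Γ) : FinGSetClass Δ →+ FinGSetClass Γ where
  toFun := Quotient.map (FinGSet.induce f) fun _ _ h => FinGSet.induce_congr f h
  map_zero' := Quotient.sound
    ⟨⟨Quotient.lift (fun a => a.2.elim) (fun a => a.2.elim), fun x => x.elim,
      by rintro ⟨a, x⟩; exact x.elim, fun x => x.elim⟩, by rintro g ⟨a, x⟩; exact x.elim⟩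
  map_add' := by
    rintro ⟨X⟩ ⟨Y⟩
    exact Quotient.sound (FinGSet.induce_sum f X Y)

/-- Coinduction `X ↦ Map_Δ(Γ, X)` on isomorphism classes. -/
def coind [Finite Γ] (f : Δ →* Γ) : FinGSetClass Δ → FinGSetClass Γ :=
  Quotient.map (FinGSet.coinduce f) fun _ _ h => FinGSet.coinduce_congr f h

/-- The marks on isomorphism classes. -/
noncomputable def mark (I : Subgroup Γ) : FinGSetClass Γ →+ ℤ where
  toFun := Quotient.lift (fun X => (FinGSet.mark I X : ℤ))
    fun _ _ h => congrArg _ (FinGSet.mark_congr h)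
  map_zero' := by
    have : IsEmpty (FinGSet.empty Γ).carrier := inferInstanceAs (IsEmpty PEmpty)
    change ((FinGSet.mark I (FinGSet.empty Γ) : ℕ) : ℤ) = 0
    simp [FinGSet.mark]
  map_add' := by
    rintro ⟨X⟩ ⟨Y⟩
    change ((FinGSet.mark I (X.sum Y) : ℕ) : ℤ) = FinGSet.mark I X + FinGSet.mark I Y
    rw [FinGSet.mark_sum, Nat.cast_add]

theorem ext_mark [Finite Γ] {x y : FinGSetClass Γ} (h : ∀ I, mark I x = mark I y) : x = y := by
  obtain ⟨X, rfl⟩ := Quotient.exists_rep x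
  obtain ⟨Y, rfl⟩ := Quotient.exists_rep y
  exact Quotient.sound (FinGSet.iso_of_mark_eq fun I => Nat.cast_injective (R := ℤ) (h I))

theorem mark_coind [Finite Γ] (f : Δ →* Γ) (I : Subgroup Γ) :
    ∃ (m : ℕ) (J : Fin m → Subgroup Δ), m ≤ f.range.index ∧
      ∀ x : FinGSetClass Δ, mark I (coind f x) = ∏ i, mark (J i) x := by
  obtain ⟨m, J, hm, h⟩ := FinGSet.mark_coinduce f I
  refine ⟨m, J, hm, ?_⟩
  rintro ⟨X⟩
  change ((FinGSet.mark I (X.coinduce f) : ℕ) : ℤ) = ∏ i, ((FinGSet.mark (J i) X : ℕ) : ℤ)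
  rw [h, Nat.cast_prod]

end FinGSetClass

/-- The Burnside ring `A(Γ)`: the Grothendieck group of the semiring of finite `Γ`-sets. -/
def BurnsideRing (Γ : Type u) [Group Γ] : Type (u + 1) :=
  Algebra.GrothendieckAddGroup (FinGSetClass Γ)

namespace BurnsideRing

variable {Γ Δ : Type u} [Group Γ] [Group Δ]

noncomputable instance instAddCommGroup : AddCommGroup (BurnsideRing Γ) :=
  inferInstanceAs (AddCommGroup (Algebra.GrothendieckAddGroup (FinGSetClass Γ)))

/-- The canonical map from isomorphism classes of finite `Γ`-sets to the Burnside ring. -/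
def of : FinGSetClass Γ →+ BurnsideRing Γ := Algebra.GrothendieckAddGroup.of

/-- The universal property of the Grothendieck group. -/
noncomputable def lift {B : Type*} [AddCommGroup B] (φ : FinGSetClass Γ →+ B) :
    BurnsideRing Γ →+ B := Algebra.GrothendieckAddGroup.lift φ

@[simp] theorem lift_of {B : Type*} [AddCommGroup B] (φ : FinGSetClass Γ →+ B)
    (x : FinGSetClass Γ) : lift φ (of x) = φ x :=
  DFunLike.congr_fun (Algebra.GrothendieckAddGroup.lift.symm_apply_apply φ) x

theorem mk_eq (a : FinGSetClass Γ) (b : (⊤ : AddSubmonoid (FinGSetClass Γ))) :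
    (AddLocalization.mk a b : BurnsideRing Γ) = of a - of b.1 := by
  have h : (of a - of b.1 : BurnsideRing Γ) = AddLocalization.mk (a + 0) (0 + ⟨b.1, AddSubmonoid.mem_top _⟩) :=
    Algebra.GrothendieckAddGroup.mk_sub_mk a b.1 0 0
  rw [h, add_zero, zero_add]

theorem exists_rep (x : BurnsideRing Γ) : ∃ a b : FinGSetClass Γ, x = of a - of b := by
  induction x using AddLocalization.ind with
  | _ p => exact ⟨p.1, p.2.1, mk_eq _ _⟩

/-- The product on the Burnside ring: the biadditive extension of the Cartesian product. -/
noncomputable def mulHom : BurnsideRing Γ →+ BurnsideRing Γ →+ BurnsideRing Γ :=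
  lift
    { toFun := fun a => lift (of.comp (AddMonoidHom.mulLeft a))
      map_zero' := by
        refine AddMonoidHom.ext fun x => ?_
        obtain ⟨c, d, rfl⟩ := exists_rep x
        simp
      map_add' := fun a b => by
        refine AddMonoidHom.ext fun x => ?_
        obtain ⟨c, d, rfl⟩ := exists_rep x
        simp [add_mul]
        try abel }

@[simp] theorem mulHom_of (a b : FinGSetClass Γ) : mulHom (of a) (of b) = of (a * b) := by
  simp [mulHom]

noncomputable instance instCommRing : CommRing (BurnsideRing Γ) where
  __ := instAddCommGroup
  mul x y := mulHom x y
  one := of 1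
  left_distrib x y z := map_add (mulHom x) y z
  right_distrib x y z := by
    change mulHom (x + y) z = mulHom x z + mulHom y z
    rw [map_add, AddMonoidHom.add_apply]
  zero_mul x := by
    change mulHom 0 x = 0
    rw [map_zero, AddMonoidHom.zero_apply]
  mul_zero x := map_zero (mulHom x)
  mul_assoc x y z := by
    change mulHom (mulHom x y) z = mulHom x (mulHom y z)
    obtain ⟨a, b, rfl⟩ := exists_rep x
    obtain ⟨c, d, rfl⟩ := exists_rep y
    obtain ⟨e, f, rfl⟩ := exists_rep z
    simp only [map_sub, AddMonoidHom.sub_apply, mulHom_of, mul_assoc]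
  one_mul x := by
    change mulHom (of 1) x = x
    obtain ⟨a, b, rfl⟩ := exists_rep x
    simp
  mul_one x := by
    change mulHom x (of 1) = x
    obtain ⟨a, b, rfl⟩ := exists_rep x
    simp
  mul_comm x y := by
    change mulHom x y = mulHom y x
    obtain ⟨a, b, rfl⟩ := exists_rep x
    obtain ⟨c, d, rfl⟩ := exists_rep y
    simp only [map_sub, AddMonoidHom.sub_apply, mulHom_of, mul_comm]
    abel

/-- The class in `A(Γ)` of the transitive `Γ`-set `Γ/K`. -/
noncomputable def coset [Finite Γ] (K : Subgroup Γ) : BurnsideRing Γ := of (FinGSetClass.mk (FinGSet.coset K))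

/-- The mark homomorphism `φ^I : A(Γ) → ℤ`, `X ↦ |X^I|`. -/
noncomputable def mark (I : Subgroup Γ) : BurnsideRing Γ →+ ℤ := lift (FinGSetClass.mark I)

theorem ext_mark [Finite Γ] {x y : BurnsideRing Γ} (h : ∀ I, mark I x = mark I y) : x = y := by
  obtain ⟨a, b, rfl⟩ := exists_rep x
  obtain ⟨c, d, rfl⟩ := exists_rep y
  have : a + d = c + b := FinGSetClass.ext_mark fun I => by
    have := h I
    simp only [mark, map_sub, lift_of] at this
    rw [map_add, map_add]
    linarith
  rw [sub_eq_sub_iff_add_eq_add, ← map_add, ← map_add, this]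

/-- Restriction `A(Γ) → A(Δ)` along a homomorphism `f : Δ → Γ`. -/
noncomputable def res (f : Δ →* Γ) : BurnsideRing Γ →+ BurnsideRing Δ :=
  lift (of.comp (FinGSetClass.res f))

/-- Transfer `A(Δ) → A(Γ)`, the additive extension of `X ↦ Γ ×_Δ X`. -/
noncomputable def tr [Finite Γ] (f : Δ →* Γ) : BurnsideRing Δ →+ BurnsideRing Γ :=
  lift (of.comp (FinGSetClass.tr f))

/-- The value of the norm on the virtual `Δ`-set `a - b`. With `n` the index of `Δ` in `Γ`, the
map `t ↦ Map_Δ(Γ, a + t b)` is polynomial of degree at most `n` in `t`, and the formula is the value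
at `t = -1` obtained from the vanishing of its `(n + 1)`-st differences. -/
noncomputable def normAux [Finite Γ] (f : Δ →* Γ) (a b : FinGSetClass Δ) : BurnsideRing Γ :=
  ∑ j ∈ Finset.range (f.range.index + 1),
    ((-1 : ℤ) ^ j * ((f.range.index + 1).choose (j + 1) : ℤ)) •
      of (FinGSetClass.coind f (a + j • b))

theorem alternating_sum_prod {m n : ℕ} (hmn : m ≤ n) (u v : Fin m → ℤ) :
    ∑ j ∈ Finset.range (n + 1),
      ((-1 : ℤ) ^ j * ((n + 1).choose (j + 1) : ℤ)) * ∏ i, (u i + j * v i) = ∏ i, (u i - v i) := by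
  let P : Polynomial ℤ := ∏ i, (Polynomial.C (v i) * Polynomial.X + Polynomial.C (u i - v i))
  have hdeg : P.natDegree < n + 1 := by
    refine Nat.lt_succ_of_le ((Polynomial.natDegree_prod_le _ _).trans ?_)
    refine (Finset.sum_le_card_nsmul _ _ 1 fun i _ => Polynomial.natDegree_linear_le).trans ?_
    simpa using hmn
  have hP : ∀ t : ℤ, P.eval t = ∏ i, (v i * t + (u i - v i)) := fun t => by
    simp [P, Polynomial.eval_prod]
  have h0 := congrFun (Polynomial.fwdDiff_iter_eq_zero_of_degree_lt hdeg) (0 : ℤ)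
  rw [fwdDiff_iter_eq_sum_shift, Finset.sum_range_succ'] at h0
  simp only [hP, zero_add, Pi.zero_apply, smul_eq_mul, nsmul_eq_mul] at h0
  have h1 : (-1 : ℤ) ^ (n + 1) * (-1) ^ (n + 1) = 1 := by
    rw [← mul_pow]; simp
  have key := congrArg (fun z => (-1 : ℤ) ^ (n + 1) * z) h0
  simp only [mul_add, Finset.mul_sum, mul_zero] at key
  have e1 : ∀ j ∈ Finset.range (n + 1),
      (-1 : ℤ) ^ (n + 1) * ((-1) ^ (n + 1 - (j + 1)) * ((n + 1).choose (j + 1) : ℤ) *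
        ∏ i, (v i * ((j + 1 : ℕ) * 1 : ℤ) + (u i - v i))) =
      -(((-1 : ℤ) ^ j * ((n + 1).choose (j + 1) : ℤ)) * ∏ i, (u i + j * v i)) := by
    intro j hj
    have hj' : j + 1 ≤ n + 1 := by simpa using hj
    have hs : (-1 : ℤ) ^ (n + 1) * (-1) ^ (n + 1 - (j + 1)) = -(-1) ^ j := by
      obtain ⟨k, hk⟩ := Nat.exists_eq_add_of_le hj'
      rw [hk, Nat.add_sub_cancel_left, pow_add, mul_assoc, ← mul_pow]
      simp [pow_succ]
    have hprod : ∏ i, (v i * ((j + 1 : ℕ) * 1 : ℤ) + (u i - v i)) = ∏ i, (u i + j * v i) :=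
      Finset.prod_congr rfl fun i _ => by push_cast; ring
    rw [hprod, ← mul_assoc, ← mul_assoc, hs]
    ring
  rw [Finset.sum_congr rfl e1, Finset.sum_neg_distrib] at key
  simp only [Nat.cast_zero, mul_zero, zero_add, Nat.sub_zero, Nat.choose_zero_right,
    Nat.cast_one, mul_one, ← mul_assoc, h1, one_mul] at key
  linarith

/-- The marks of the norm of a virtual set. -/
theorem mark_normAux [Finite Γ] (f : Δ →* Γ) (I : Subgroup Γ) :
    ∃ (m : ℕ) (J : Fin m → Subgroup Δ),
      (∀ a b : FinGSetClass Δ, mark I (normAux f a b) = ∏ i, mark (J i) (of a - of b)) := by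
  obtain ⟨m, J, hm, h⟩ := FinGSetClass.mark_coind f I
  refine ⟨m, J, fun a b => ?_⟩
  have e := alternating_sum_prod hm (fun i => FinGSetClass.mark (J i) a)
    (fun i => FinGSetClass.mark (J i) b)
  simp only [mark, map_sub, lift_of]
  rw [← e, normAux, map_sum]
  refine Finset.sum_congr rfl fun j _ => ?_
  rw [map_zsmul, lift_of, h, smul_eq_mul]
  congr 1
  refine Finset.prod_congr rfl fun i _ => ?_
  rw [map_add, map_nsmul, nsmul_eq_mul]

/-- The norm `A(Δ) → A(Γ)`: the polynomial extension of `X ↦ Map_Δ(Γ, X)` to virtual sets. -/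
noncomputable def norm [Finite Γ] (f : Δ →* Γ) (x : BurnsideRing Δ) : BurnsideRing Γ :=
  AddLocalization.liftOn x (fun a b => normAux f a b.1) (by
    intro a c b d hr
    have hx : (of a - of b.1 : BurnsideRing Δ) = of c - of d.1 := by
      rw [← mk_eq, ← mk_eq]
      exact AddLocalization.mk_eq_mk_iff.2 hr
    refine ext_mark fun I => ?_
    obtain ⟨m, J, h⟩ := mark_normAux f I
    rw [h, h, hx])

theorem norm_sub [Finite Γ] (f : Δ →* Γ) (a b : FinGSetClass Δ) :
    norm f (of a - of b) = normAux f a b :=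
  (congrArg (norm f) (mk_eq a ⟨b, AddSubmonoid.mem_top _⟩)).symm

/-- On genuine sets the norm is `X ↦ Map_Δ(Γ, X)`. -/
theorem norm_of [Finite Γ] (f : Δ →* Γ) (a : FinGSetClass Δ) :
    norm f (of a) = of (FinGSetClass.coind f a) := by
  have h0 : norm f (of a) = normAux f a 0 := by
    rw [← norm_sub, map_zero, sub_zero]
  rw [h0]
  have h1 := alternating_sum_prod (m := 0) (Nat.zero_le f.range.index) Fin.elim0 Fin.elim0
  simp only [Finset.univ_eq_empty, Finset.prod_empty, mul_one] at h1
  simp only [normAux, nsmul_zero, add_zero]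
  rw [← Finset.sum_smul, h1, one_smul]

end BurnsideRing

/-! ### Ideals of the Burnside Tambara functor -/

section Tambara

variable {G : Type u} [Group G]

/-- The conjugate `H^g = g⁻¹ H g`. -/
def conjSubgroup (H : Subgroup G) (g : G) : Subgroup G := H.comap (MulAut.conj g).toMonoidHom

/-- The isomorphism `H^g → H`, `y ↦ g y g⁻¹`. -/
def conjHom (H : Subgroup G) (g : G) : conjSubgroup H g →* H :=
  (MulAut.conj g).toMonoidHom.subgroupComap H

namespace BurnsideTambara

/-- Restriction `res^H_K : A(H) → A(K)` for `K ≤ H`. -/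
noncomputable def res {K H : Subgroup G} (h : K ≤ H) : BurnsideRing H →+ BurnsideRing K :=
  BurnsideRing.res (Subgroup.inclusion h)

/-- Transfer `tr_K^H : A(K) → A(H)` for `K ≤ H`. -/
noncomputable def tr [Finite G] {K H : Subgroup G} (h : K ≤ H) :
    BurnsideRing K →+ BurnsideRing H :=
  BurnsideRing.tr (Subgroup.inclusion h)

/-- Norm `N_K^H : A(K) → A(H)` for `K ≤ H`. -/
noncomputable def norm [Finite G] {K H : Subgroup G} (h : K ≤ H) :
    BurnsideRing K → BurnsideRing H :=
  BurnsideRing.norm (Subgroup.inclusion h)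

/-- Conjugation `c_{g,H} : A(H) → A(H^g)`, sending an `H`-set `X` to `X` with `y ∈ H^g` acting
as `g y g⁻¹`. -/
noncomputable def conj (H : Subgroup G) (g : G) :
    BurnsideRing H →+ BurnsideRing (conjSubgroup H g) :=
  BurnsideRing.res (conjHom H g)

/-- An ideal `I` of the Burnside Tambara functor of `G`: an ideal of `A(H)`, the value at `G/H`, for
every `H ≤ G`, compatible with restrictions, transfers, norms (up to the norm of zero) and
conjugations. -/
structure TambaraIdeal (G : Type u) [Group G] [Finite G] where
  /-- The value `I(G/H)`. -/
  obj : ∀ H : Subgroup G, Ideal (BurnsideRing H)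
  res_mem : ∀ {K H : Subgroup G} (h : K ≤ H), ∀ x ∈ obj H, res h x ∈ obj K
  tr_mem : ∀ {K H : Subgroup G} (h : K ≤ H), ∀ x ∈ obj K, tr h x ∈ obj H
  norm_mem : ∀ {K H : Subgroup G} (h : K ≤ H), ∀ x ∈ obj K, ∃ y ∈ obj H, norm h x = y + norm h 0
  conj_mem : ∀ (H : Subgroup G) (g : G), ∀ x ∈ obj H, conj H g x ∈ obj (conjSubgroup H g)

namespace TambaraIdeal

variable [Finite G]

/-- Containment of ideals. -/
def Le (I J : TambaraIdeal G) : Prop := ∀ H : Subgroup G, ∀ x ∈ I.obj H, x ∈ J.obj H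

/-- The product `(I J)(G/H) = { f₊(a b) | f : A → G/H a map of finite G-sets, a ∈ I(A), b ∈ J(A) }`.
Such an `A` is a finite disjoint union of orbits `G/Kᵢ`, with `I(A)` the product of the `I(G/Kᵢ)`;
on `G/Kᵢ` the map `f` has the form `x Kᵢ ↦ x gᵢ H` with `gᵢ⁻¹ Kᵢ gᵢ ≤ H`, and `f₊` is the sum over
`i` of conjugation by `gᵢ` followed by transfer. -/
def mulSet (I J : TambaraIdeal G) (H : Subgroup G) : Set (BurnsideRing H) :=
  { x | ∃ (n : ℕ) (K : Fin n → Subgroup G) (g : Fin n → G)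
      (h : ∀ i, conjSubgroup (K i) (g i) ≤ H) (a b : ∀ i, BurnsideRing (K i)),
      (∀ i, a i ∈ I.obj (K i)) ∧ (∀ i, b i ∈ J.obj (K i)) ∧
      x = ∑ i, tr (h i) (conj (K i) (g i) (a i * b i)) }

/-- `P` is prime if `I J ⊆ P` implies `I ⊆ P` or `J ⊆ P` for all ideals `I`, `J`. Properness of `P`
is not required. -/
def IsPrime (P : TambaraIdeal G) : Prop :=
  ∀ I J : TambaraIdeal G, (∀ H : Subgroup G, mulSet I J H ⊆ P.obj H) → Le I P ∨ Le J P

end TambaraIdeal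

end BurnsideTambara

end Tambara

/-! For an integer `n`, let `D_n` consist of all elements of the Burnside rings whose marks are all
divisible by `n`. For abelian `G` this is an ideal (`ofDvdMark`). Restriction and conjugation only
reindex marks, and each mark of a norm is a nonempty product of marks. Transfers are the delicate
case, handled by `dvd_coeff_mul_index`: if all marks of `∑ c_K [Γ/K]` are divisible by `n`, then so
is every `c_K |Γ:K|`, although `c_K` itself need not be.

Marks are multiplicative, so `D_m D_n ⊆ D_{mn}`. A prime ideal containing `D_{p^k}` for some `k`
therefore contains `D_p`, and `p • 1` lies in `D_p`. It remains to find such a `k`.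

Norming `p • 1` up from the trivial subgroup gives an element of `P(G/H)` whose coefficient at `H/H`
is a power of `p`. The other terms are multiples of transfers of units from proper subgroups, so
induction on `H` yields a power of `p` in `P(G/H)` (`exists_pow_smul_one_mem`). If the marks of `∑
c_K [H/K]` are divisible by a high enough power of `p`, then the index `|H:K|` can absorb only the
`p`-part of `|G|`. Each `c_K` is then divisible by the power of `p` that puts `c_K [H/K]` into `P`
(`exists_ofDvdMark_pow_le`). The case `p = 0` is trivial. -/

/-! ### Orbit decomposition, induction of orbits, and marks of finite sets -/

namespace FinGSet

variable {Γ Δ : Type u} [Group Γ] [Group Δ]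

/-- A nonempty `Γ`-set is the disjoint union of an orbit and a smaller `Γ`-set. -/
theorem exists_iso_coset_sum [Finite Γ] (X : FinGSet Γ) (x : X.carrier) :
    ∃ R : FinGSet Γ, Nat.card R.carrier < Nat.card X.carrier ∧
      Iso X ((coset (MulAction.stabilizer Γ x)).sum R) := by
  classical
  let a : MulAction Γ { w : X.carrier // ¬ w ∈ MulAction.orbit Γ x } :=
    { smul := fun g w => ⟨g • w.1, fun hw => w.2 <| by
        rw [← inv_smul_smul g w.1]
        exact MulAction.mem_orbit_of_mem_orbit _ hw⟩
      one_smul := fun w => Subtype.ext (one_smul _ _)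
      mul_smul := fun g h w => Subtype.ext (mul_smul _ _ _) }
  refine ⟨{ carrier := { w : X.carrier // ¬ w ∈ MulAction.orbit Γ x } },
    Finite.card_subtype_lt (x := x) (by simp), Iso.symm ?_⟩
  refine ⟨(Equiv.sumCongr (MulAction.orbitEquivQuotientStabilizer Γ x).symm
    (Equiv.refl _)).trans (Equiv.sumCompl (fun w => w ∈ MulAction.orbit Γ x)), ?_⟩
  rintro g (c | w)
  · obtain ⟨h, rfl⟩ := QuotientGroup.mk_surjective (s := MulAction.stabilizer Γ x) c
    exact mul_smul g h x
  · rfl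

/-- Inducing a transitive set gives a transitive set. -/
theorem induce_coset [Finite Γ] [Finite Δ] (f : Δ →* Γ) (K : Subgroup Δ) :
    Iso ((coset K).induce f) (coset (K.map f)) := by
  -- The bijection sends the class of `(g, dK)` to `g f(d) f(K)`; its inverse sends `g f(K)` to the
  -- class of `(g, K)`.
  refine ⟨⟨Quotient.lift (fun a : Γ × Δ ⧸ K => Quotient.liftOn' a.2
      (fun d => (QuotientGroup.mk (a.1 * f d) : Γ ⧸ K.map f)) ?_) ?_,
    fun c => Quotient.liftOn' c
      (fun g => Quotient.mk (inducedSetoid f (coset K)) (g, (QuotientGroup.mk 1 : Δ ⧸ K))) ?_,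
    ?_, ?_⟩, ?_⟩
  · intro d e hde
    rw [QuotientGroup.leftRel_apply] at hde
    exact QuotientGroup.eq.2 ⟨d⁻¹ * e, hde, by simp [mul_assoc]⟩
  · rintro ⟨g, ⟨d⟩⟩ ⟨g', d'⟩ ⟨k, h1, h2⟩
    change g = g' * f k at h1
    change d' = QuotientGroup.mk (k * d) at h2
    subst h1 h2
    change (QuotientGroup.mk (g' * f k * f d) : Γ ⧸ K.map f) = QuotientGroup.mk (g' * f (k * d))
    rw [map_mul, mul_assoc]
  · intro g g' hg
    rw [QuotientGroup.leftRel_apply] at hg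
    obtain ⟨k, hk, hk'⟩ := hg
    refine Quotient.sound ⟨k⁻¹, ?_, ?_⟩
    · change g = g' * f k⁻¹
      rw [map_inv, hk']
      group
    · change (QuotientGroup.mk 1 : Δ ⧸ K) = QuotientGroup.mk (k⁻¹ * 1)
      rw [QuotientGroup.eq]
      simpa using hk
  · rintro ⟨g, ⟨d⟩⟩
    refine Quotient.sound ⟨d, rfl, ?_⟩
    change (QuotientGroup.mk d : Δ ⧸ K) = QuotientGroup.mk (d * 1)
    rw [mul_one]
  · rintro ⟨g⟩
    change (QuotientGroup.mk (g * f 1) : Γ ⧸ K.map f) = QuotientGroup.mk g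
    rw [map_one, mul_one]
  · rintro h ⟨g, ⟨d⟩⟩
    change (QuotientGroup.mk (h * g * f d) : Γ ⧸ K.map f) = QuotientGroup.mk (h * (g * f d))
    rw [mul_assoc]

theorem mark_prod (I : Subgroup Γ) (X Y : FinGSet Γ) :
    mark I (X.prod Y) = mark I X * mark I Y := by
  unfold mark
  rw [← Nat.card_prod]
  refine Nat.card_congr ⟨fun x => (⟨x.1.1, fun g hg => congrArg Prod.fst (x.2 g hg)⟩,
    ⟨x.1.2, fun g hg => congrArg Prod.snd (x.2 g hg)⟩),
    fun x => ⟨(x.1.1, x.2.1), fun g hg => Prod.ext (x.1.2 g hg) (x.2.2 g hg)⟩,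
    fun _ => rfl, fun _ => rfl⟩

theorem mark_restrict (f : Δ →* Γ) (I : Subgroup Δ) (X : FinGSet Γ) :
    mark I (X.restrict f) = mark (I.map f) X := by
  refine Nat.card_congr (Equiv.subtypeEquivRight fun x => ⟨?_, fun h g hg => h _ ⟨g, hg, rfl⟩⟩)
  rintro h _ ⟨g, hg, rfl⟩
  exact h g hg

open Classical in
-- In an abelian group every point of `Γ/K` has stabiliser exactly `K`, so `I` fixes either all
-- points or none.
theorem mark_coset {Γ : Type u} [CommGroup Γ] [Finite Γ] (I K : Subgroup Γ) :
    mark I (coset K) = if I ≤ K then K.index else 0 := by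
  have key : ∀ x : Γ ⧸ K, (∀ g ∈ I, g • x = x) ↔ I ≤ K := by
    rintro ⟨x⟩
    refine forall₂_congr fun g _ => ?_
    change (QuotientGroup.mk (g * x) : Γ ⧸ K) = QuotientGroup.mk x ↔ _
    rw [QuotientGroup.eq]
    simp
  change Nat.card { x : Γ ⧸ K // ∀ g ∈ I, g • x = x } = _
  split_ifs with h
  · exact Nat.card_congr (Equiv.subtypeUnivEquiv fun x => (key x).2 h)
  · have : IsEmpty { x : Γ ⧸ K // ∀ g ∈ I, g • x = x } := ⟨fun x => h ((key x.1).1 x.2)⟩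
    exact Nat.card_of_isEmpty

end FinGSet

/-! ### Marks of the ring and Tambara operations; generation by orbits -/

namespace BurnsideRing

variable {Γ Δ : Type u} [Group Γ] [Group Δ]

theorem mark_mul (I : Subgroup Γ) (x y : BurnsideRing Γ) :
    mark I (x * y) = mark I x * mark I y := by
  have key : ∀ a b : FinGSetClass Γ, mark I (of a * of b) = mark I (of a) * mark I (of b) := by
    intro a b
    change mark I (mulHom (of a) (of b)) = _
    rw [mulHom_of]
    simp only [mark, lift_of]
    obtain ⟨X, rfl⟩ := Quotient.exists_rep a
    obtain ⟨Y, rfl⟩ := Quotient.exists_rep b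
    change ((FinGSet.mark I (X.prod Y) : ℕ) : ℤ) = FinGSet.mark I X * FinGSet.mark I Y
    rw [FinGSet.mark_prod, Nat.cast_mul]
  obtain ⟨a, b, rfl⟩ := exists_rep x
  obtain ⟨c, d, rfl⟩ := exists_rep y
  simp only [sub_mul, mul_sub, map_sub, key]

theorem mark_one (I : Subgroup Γ) : mark I (1 : BurnsideRing Γ) = 1 := by
  change mark I (of 1) = 1
  rw [mark, lift_of]
  change ((FinGSet.mark I (FinGSet.point Γ) : ℕ) : ℤ) = 1
  have : Unique { x : (FinGSet.point Γ).carrier // ∀ g ∈ I, g • x = x } :=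
    ⟨⟨⟨PUnit.unit, fun _ _ => rfl⟩⟩, fun _ => rfl⟩
  simp [FinGSet.mark]

theorem mark_res (f : Δ →* Γ) (I : Subgroup Δ) (x : BurnsideRing Γ) :
    mark I (res f x) = mark (I.map f) x := by
  have key : ∀ a : FinGSetClass Γ, mark I (res f (of a)) = mark (I.map f) (of a) := by
    intro a
    rw [res, lift_of, mark, mark, AddMonoidHom.comp_apply, lift_of, lift_of]
    obtain ⟨X, rfl⟩ := Quotient.exists_rep a
    exact congrArg (Nat.cast (R := ℤ)) (FinGSet.mark_restrict f I X)
  obtain ⟨a, b, rfl⟩ := exists_rep x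
  simp only [map_sub, key]

/-- The subgroups `J` do not depend on `x`, so evaluating at one convenient `x` already yields
information about `m`. -/
theorem mark_norm [Finite Γ] (f : Δ →* Γ) (I : Subgroup Γ) :
    ∃ (m : ℕ) (J : Fin m → Subgroup Δ), ∀ x, mark I (norm f x) = ∏ i, mark (J i) x := by
  obtain ⟨m, J, h⟩ := mark_normAux f I
  refine ⟨m, J, fun x => ?_⟩
  obtain ⟨a, b, rfl⟩ := exists_rep x
  rw [norm_sub, h]

/-- An equivariant map from the nonempty set `Γ` to the empty set does not exist. The correction
term `N(0)` in the definition of an ideal therefore disappears. -/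
theorem norm_zero [Finite Γ] (f : Δ →* Γ) : norm f 0 = 0 := by
  have h : FinGSetClass.coind f 0 = 0 := Quotient.sound
    ⟨⟨fun s => s.1 1, fun x => x.elim, fun s => (s.1 1).elim, fun x => x.elim⟩,
      fun _ s => (s.1 1).elim⟩
  rw [← map_zero of, norm_of, h]
  exact map_zero of

theorem tr_coset [Finite Γ] [Finite Δ] (f : Δ →* Γ) (K : Subgroup Δ) :
    tr f (coset K) = coset (K.map f) := by
  rw [coset, tr, lift_of]
  exact congrArg of (Quotient.sound (FinGSet.induce_coset f K))

/-- The Burnside ring is additively generated by the transitive sets. -/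
theorem exists_eq_sum_coset [Finite Γ] [Fintype (Subgroup Γ)] (x : BurnsideRing Γ) :
    ∃ c : Subgroup Γ → ℤ, x = ∑ K, c K • coset K := by
  classical
  have key : ∀ (n : ℕ) (X : FinGSet Γ), Nat.card X.carrier = n →
      ∃ c : Subgroup Γ → ℤ, of (FinGSetClass.mk X) = ∑ K, c K • coset K := by
    intro n
    induction n using Nat.strong_induction_on with
    | _ n ih =>
      intro X hX
      rcases isEmpty_or_nonempty X.carrier with h | ⟨⟨x⟩⟩
      · refine ⟨0, ?_⟩
        have h0 : FinGSetClass.mk X = 0 := Quotient.sound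
          ⟨⟨fun x => (h.false x).elim, fun x => x.elim, fun x => (h.false x).elim,
            fun x => x.elim⟩, fun _ x => (h.false x).elim⟩
        simp [h0]
      · obtain ⟨R, hR, hiso⟩ := X.exists_iso_coset_sum x
        obtain ⟨c, hc⟩ := ih _ (hX ▸ hR) R rfl
        -- Peeling off the orbit of `x` adds one to the coefficient of its stabiliser.
        refine ⟨c + Pi.single (MulAction.stabilizer Γ x) 1, ?_⟩
        have h0 : FinGSetClass.mk X =
            FinGSetClass.mk (FinGSet.coset (MulAction.stabilizer Γ x)) + FinGSetClass.mk R :=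
          Quotient.sound hiso
        rw [h0, map_add, hc]
        simp only [Pi.add_apply, add_smul, Finset.sum_add_distrib, Pi.single_apply, ite_smul,
          one_smul, zero_smul, Finset.sum_ite_eq', Finset.mem_univ, if_true]
        exact add_comm _ _
  obtain ⟨a, b, rfl⟩ := exists_rep x
  obtain ⟨X, rfl⟩ := Quotient.exists_rep a
  obtain ⟨Y, rfl⟩ := Quotient.exists_rep b
  obtain ⟨c, hc⟩ := key _ X rfl
  obtain ⟨d, hd⟩ := key _ Y rfl
  refine ⟨c - d, ?_⟩
  simp only [FinGSetClass.mk] at hc hd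
  rw [hc, hd]
  simp only [Pi.sub_apply, sub_smul, Finset.sum_sub_distrib]

/-! ### Divisibility of marks for abelian groups -/

section Comm

variable {Γ Δ : Type u} [CommGroup Γ] [CommGroup Δ] [Finite Γ] [Finite Δ]

open Classical in
theorem mark_coset (I K : Subgroup Γ) :
    mark I (coset K) = if I ≤ K then (K.index : ℤ) else 0 := by
  rw [coset, mark, lift_of]
  refine (congrArg Nat.cast (FinGSet.mark_coset I K)).trans ?_
  split_ifs <;> simp

theorem coset_top : coset (⊤ : Subgroup Γ) = 1 :=
  ext_mark fun I => by simp [mark_coset, mark_one]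

/-- Triangularity of the table of marks of an abelian group, without loss of divisibility. -/
theorem dvd_coeff_mul_index [Fintype (Subgroup Γ)] {n : ℤ} (c : Subgroup Γ → ℤ)
    (h : ∀ I, n ∣ mark I (∑ K, c K • coset K)) (K : Subgroup Γ) : n ∣ c K * K.index := by
  classical
  -- Downward induction from `⊤`: the mark at `K` sees only the orbits `Γ/L` with `K ≤ L`, and each
  -- contributes `c L * L.index`. The terms with `L` strictly larger are divisible by the induction
  -- hypothesis, which leaves the term of `K`.
  induction K using WellFoundedGT.induction with
  | _ K ih =>
    have hK := h K
    rw [map_sum, ← Finset.add_sum_erase _ _ (Finset.mem_univ K)] at hK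
    rw [(Int.dvd_add_left (Finset.dvd_sum ?_)).symm]
    · convert hK using 2
      rw [map_zsmul, mark_coset, if_pos le_rfl, smul_eq_mul]
    · intro L hL
      rw [map_zsmul, mark_coset, smul_eq_mul]
      split_ifs with hKL
      · exact ih L (lt_of_le_of_ne hKL (Finset.ne_of_mem_erase hL).symm)
      · simp

/-- Transfer carries `Δ/K` to `Γ/f(K)`, whose nonzero marks equal `|Γ:f(K)| = |Δ:K| |Γ:f(Δ)|` by
injectivity. The factor `|Δ:K|` is what makes the coefficient `c_K` divisible by `n`. -/
theorem dvd_mark_tr {f : Δ →* Γ} (hf : Function.Injective f) {n : ℤ} {x : BurnsideRing Δ}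
    (h : ∀ I, n ∣ mark I x) (I : Subgroup Γ) : n ∣ mark I (tr f x) := by
  classical
  have : Fintype (Subgroup Δ) := Fintype.ofFinite _
  obtain ⟨c, rfl⟩ := exists_eq_sum_coset x
  rw [map_sum, map_sum]
  refine Finset.dvd_sum fun K _ => ?_
  rw [map_zsmul, tr_coset, map_zsmul, mark_coset, smul_eq_mul]
  split_ifs
  · rw [Subgroup.index_map, (MonoidHom.ker_eq_bot_iff f).2 hf, sup_bot_eq, Nat.cast_mul,
      ← mul_assoc]
    exact (dvd_coeff_mul_index c h K).mul_right _
  · simp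

end Comm

end BurnsideRing

/-! ### Ideals defined by divisibility of marks, and their containment in a prime ideal -/

namespace BurnsideTambara

namespace TambaraIdeal

variable {G : Type u} [CommGroup G] [Finite G]

/-- The ideal of all elements whose marks are divisible by `n`. -/
noncomputable def ofDvdMark (G : Type u) [CommGroup G] [Finite G] (n : ℤ) : TambaraIdeal G where
  obj H :=
    { carrier := { x | ∀ I, n ∣ BurnsideRing.mark I x }
      add_mem' := fun hx hy I => by
        rw [map_add]
        exact dvd_add (hx I) (hy I)
      zero_mem' := fun I => by simp
      smul_mem' := fun c x hx I => by
        rw [smul_eq_mul, BurnsideRing.mark_mul]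
        exact (hx I).mul_left _ }
  res_mem h x hx I := by
    rw [res, BurnsideRing.mark_res]
    exact hx _
  tr_mem h x hx I := BurnsideRing.dvd_mark_tr (Subgroup.inclusion_injective h) hx I
  norm_mem h x hx := by
    refine ⟨norm h x, fun I => ?_, by
      unfold norm
      rw [BurnsideRing.norm_zero, add_zero]⟩
    obtain ⟨m, J, hJ⟩ := BurnsideRing.mark_norm (Subgroup.inclusion h) I
    rw [norm, hJ]
    -- An empty product would give `norm 0 = 0` the mark `1`. Hence there is at least one factor,
    -- and it is divisible by `n`.
    have hm : m ≠ 0 := by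
      rintro rfl
      simpa [BurnsideRing.norm_zero] using hJ 0
    exact (hx _).trans (Finset.dvd_prod_of_mem _ (Finset.mem_univ ⟨0, Nat.pos_of_ne_zero hm⟩))
  conj_mem H g x hx I := by
    rw [conj, BurnsideRing.mark_res]
    exact hx _

/-- Multiplicativity of marks handles each product `a i * b i`; conjugation, transfer and sums then
stay inside the target because it is an ideal. -/
theorem mulSet_ofDvdMark (m n : ℤ) (H : Subgroup G) :
    mulSet (ofDvdMark G m) (ofDvdMark G n) H ⊆ (ofDvdMark G (m * n)).obj H := by
  rintro _ ⟨k, K, g, h, a, b, ha, hb, rfl⟩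
  refine Ideal.sum_mem _ fun i _ => tr_mem _ _ _ (conj_mem _ _ _ _ fun I => ?_)
  rw [BurnsideRing.mark_mul]
  exact mul_dvd_mul (ha i I) (hb i I)

/-- The orbit `H/K` is the transfer of the unit of `A(K)`, so a multiple of that unit in `P` gives
the same multiple of `H/K`. The image `K.map H.subtype` appears because `P` is indexed by subgroups
of `G`. -/
theorem smul_coset_mem (P : TambaraIdeal G) {H : Subgroup G} (K : Subgroup H) {n c : ℤ}
    (hn : n ∣ c) (h : n • (1 : BurnsideRing (K.map H.subtype)) ∈ P.obj (K.map H.subtype)) :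
    c • BurnsideRing.coset K ∈ P.obj H := by
  obtain ⟨d, rfl⟩ := hn
  have hle : K.map H.subtype ≤ H := Subgroup.map_subtype_le K
  have htr : tr hle 1 = BurnsideRing.coset K := by
    rw [← BurnsideRing.coset_top, tr, BurnsideRing.tr_coset, ← MonoidHom.range_eq_map,
      Subgroup.inclusion_range]
    exact congrArg _ (Subgroup.comap_map_eq_self_of_injective H.subtype_injective K)
  rw [mul_comm, mul_smul, ← htr, ← map_zsmul]
  exact zsmul_mem (P.tr_mem hle _ h) d

/-- If a multiple `p` of the trivial subgroup's unit lies in `P`, then so does a multiple `p ^ k` of every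
subgroup's unit. -/
theorem exists_pow_smul_one_mem (P : TambaraIdeal G) {p : ℤ}
    (hp : p • (1 : BurnsideRing (⊥ : Subgroup G)) ∈ P.obj ⊥) (H : Subgroup G) :
    ∃ k : ℕ, p ^ k • (1 : BurnsideRing H) ∈ P.obj H := by
  classical
  induction H using WellFoundedLT.induction with
  | _ H ih =>
    have : Fintype (Subgroup H) := Fintype.ofFinite _
    have hlt : ∀ K : Subgroup H, K ≠ ⊤ → K.map H.subtype < H := by
      intro K hK
      refine lt_of_le_of_ne (Subgroup.map_subtype_le K) fun h => hK ?_
      rw [← Subgroup.comap_map_eq_self_of_injective H.subtype_injective K, h]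
      exact Subgroup.subgroupOf_self H
    -- Exponents are chosen for every `K`, with the dummy value `0` at `⊤`, so that they can be
    -- summed over all subgroups.
    have : ∀ K : Subgroup H, ∃ k : ℕ, K ≠ ⊤ →
        p ^ k • (1 : BurnsideRing (K.map H.subtype)) ∈ P.obj _ := by
      intro K
      by_cases hK : K = ⊤
      · exact ⟨0, fun h => (h hK).elim⟩
      · obtain ⟨k, hk⟩ := ih _ (hlt K hK)
        exact ⟨k, fun _ => hk⟩
    choose k hk using this
    obtain ⟨y, hy, hxy⟩ := P.norm_mem (bot_le : ⊥ ≤ H) _ hp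
    unfold norm at hxy
    rw [BurnsideRing.norm_zero, add_zero] at hxy
    subst hxy
    obtain ⟨m, J, hJ⟩ := BurnsideRing.mark_norm (Subgroup.inclusion (bot_le : ⊥ ≤ H)) ⊤
    obtain ⟨c, hc⟩ := BurnsideRing.exists_eq_sum_coset
      (BurnsideRing.norm (Subgroup.inclusion (bot_le : ⊥ ≤ H)) (p • 1))
    -- The mark at the whole group vanishes on every proper orbit, so it reads off the coefficient
    -- of `H/H`. Each of the `m` factors in the product formula is a mark of `p • 1`, which is `p`.
    have hcm : c ⊤ = p ^ m := by
      have h1 := hJ (p • 1)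
      rw [hc] at h1
      simp only [map_sum, map_zsmul, BurnsideRing.mark_coset, BurnsideRing.mark_one] at h1
      simpa using h1
    -- The factor `p ^ ∑ K, k K` pushes all proper orbit terms into `P` at once; `p ^ m` is the
    -- coefficient that remains on the unit.
    refine ⟨∑ K, k K + m, ?_⟩
    rw [hc, ← Finset.add_sum_erase _ _ (Finset.mem_univ ⊤), BurnsideRing.coset_top, hcm] at hy
    have hy' := zsmul_mem hy (p ^ ∑ K, k K)
    rw [smul_add, smul_smul, ← pow_add] at hy'
    refine (Ideal.add_mem_iff_left _ ?_).1 hy'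
    rw [Finset.smul_sum]
    refine Ideal.sum_mem _ fun K hK => ?_
    rw [smul_smul]
    exact P.smul_coset_mem K ((pow_dvd_pow p (Finset.single_le_sum (fun _ _ => Nat.zero_le _)
      (Finset.mem_univ K))).mul_right _) (hk K (Finset.ne_of_mem_erase hK))

/-- If the unit of the trivial subgroup is killed by the prime `p` modulo `P`, then `P` contains
all elements whose marks are divisible by a high power of `p`. -/
theorem exists_ofDvdMark_pow_le (P : TambaraIdeal G) {p : ℤ} (hp : Prime p)
    (hpe : p • (1 : BurnsideRing (⊥ : Subgroup G)) ∈ P.obj ⊥) :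
    ∃ k : ℕ, Le (ofDvdMark G (p ^ k)) P := by
  classical
  have : Fintype (Subgroup G) := Fintype.ofFinite _
  choose k hk using P.exists_pow_smul_one_mem hpe
  have hG : (Nat.card G : ℤ) ≠ 0 := by exact_mod_cast Nat.card_pos.ne'
  have hfin : FiniteMultiplicity p (Nat.card G : ℤ) := .of_prime_left hp hG
  obtain ⟨d, hv, hd⟩ := hfin.exists_eq_pow_mul_and_not_dvd
  set v := multiplicity p (Nat.card G : ℤ)
  -- The exponent must serve all `H` simultaneously. The sum runs over all subgroups of `G` and so
  -- dominates each `k L`; `v` pays for the `p`-part of the indices `|H:K|`, which divide `|G| = p ^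
  -- v * d`.
  refine ⟨v + ∑ L, k L, fun H x hx => ?_⟩
  have : Fintype (Subgroup H) := Fintype.ofFinite _
  obtain ⟨c, rfl⟩ := BurnsideRing.exists_eq_sum_coset x
  refine Ideal.sum_mem _ fun K _ => ?_
  refine P.smul_coset_mem K ((pow_dvd_pow p (Finset.single_le_sum (fun _ _ => Nat.zero_le _)
    (Finset.mem_univ _))).trans (b := p ^ ∑ L, k L) ?_) (hk _)
  have h1 : (K.index : ℤ) ∣ p ^ v * d := by
    rw [← hv]
    exact_mod_cast K.index_dvd_card.trans H.card_subgroup_dvd_card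
  have h2 := (BurnsideRing.dvd_coeff_mul_index c hx K).trans (mul_dvd_mul_left (c K) h1)
  rw [pow_add, mul_left_comm] at h2
  -- Cancelling `p ^ v` leaves `p ^ ∑ L, k L ∣ c K * d`, and `d` is prime to `p`.
  exact hp.pow_dvd_of_dvd_mul_right _ hd
    ((mul_dvd_mul_iff_left (pow_ne_zero v hp.ne_zero)).1 h2)

/-- The square of the ideal for `n ^ 2 ^ j` lies in the ideal for `n ^ 2 ^ (j + 1)`, so primality
halves the exponent until it reaches `1`. A general `k` reduces to a power of two because `k ≤ 2 ^
k`. -/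
theorem IsPrime.ofDvdMark_le_of_pow {P : TambaraIdeal G} (hP : P.IsPrime) {n : ℤ} {k : ℕ}
    (h : Le (ofDvdMark G (n ^ k)) P) : Le (ofDvdMark G n) P := by
  have hpow : ∀ j : ℕ, Le (ofDvdMark G (n ^ 2 ^ j)) P → Le (ofDvdMark G n) P := by
    intro j
    induction j with
    | zero => simp
    | succ j ih =>
      intro hj
      rw [pow_succ, mul_two, pow_add] at hj
      exact ih (or_self_iff.1 (hP _ _ fun H x hx => hj H x (mulSet_ofDvdMark _ _ H hx)))
  exact hpow k fun H x hx =>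
    h H x fun I => (pow_dvd_pow n k.lt_two_pow_self.le).trans (hx I)

end TambaraIdeal

end BurnsideTambara

theorem theorem4p5 {G : Type u} [CommGroup G] [Finite G]
    (P : BurnsideTambara.TambaraIdeal G) (hP : P.IsPrime)
    (p : ℕ) (hp : p.Prime ∨ p = 0)
    (hpe : p • BurnsideRing.coset (⊤ : Subgroup (⊥ : Subgroup G)) ∈ P.obj ⊥)
    (H : Subgroup G) :
    p • BurnsideRing.coset (⊤ : Subgroup H) ∈ P.obj H := by
  rcases hp with hp | rfl
  · rw [BurnsideRing.coset_top, ← natCast_zsmul] at hpe ⊢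
    obtain ⟨k, hk⟩ := P.exists_ofDvdMark_pow_le (Nat.prime_iff_prime_int.1 hp) hpe
    -- It suffices that `p • 1` has all its marks divisible by `p`.
    refine hP.ofDvdMark_le_of_pow hk H _ fun I => ?_
    rw [map_zsmul, smul_eq_mul]
    exact dvd_mul_right _ _
  · rw [zero_smul]
    exact zero_mem _
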